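/- **Theorem.** Let $\mathcal S^n$ be the space of real symmetric $n\times n$ matrices, $m=\tfrac{n(n+1)}2$, and let $\operatorname{svec}:\mathcal S^n\to\mathbb R^m$ list the diagonal entries of a matrix together with its entries above the diagonal multiplied by $\sqrt2$. Let $\mathbb S^{k-1}$ be the Euclidean unit sphere of $\mathbb R^k$. For $q\in\{1,2\}$ put $\|X\|_{\psi_q}:=\inf\{t>0:\mathbb E[\exp(|X|^q/t^q)]\le 2\}$ for a real random variable $X$ (with $\inf\emptyset=\infty$) and $\|\boldsymbol\xi\|_{\psi_q}:=\sup_{\mathbf y\in\mathbb S^{m-1}}\|\mathbf y^\top\boldsymbol\xi\|_{\psi_q}$ for a random vector $\boldsymbol\xi\in\mathbb R^m$; $\boldsymbol\xi$ is sub-exponential if $\|\boldsymbol\xi\|_{\psi_1}<\infty$ and sub-Gaussian if $\|\boldsymbol\xi\|_{\psi_2}<\infty$. There is an absolute constant $C>0$ such that the following holds for all $n$, all $N\ge1$ and all $\beta\in(0,1)$. Let $\widehat{\mathsf Q}_1,\dots,\widehat{\mathsf Q}_N$ be i.i.d. random matrices in $\mathcal S^n$ with distribution $\mathbb P_{\rm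 true}$, let $\widehat{\boldsymbol\xi}_i=\operatorname{svec}(\widehat{\mathsf Q}_i)$, let $\widehat{\mathbb P}_N=\frac1N\sum_{i=1}^N\delta_{\widehat{\mathsf Q}_i}$ be the empirical distribution, and let $$\mathsf D:=\mathbb E_{\widehat{\mathbb P}_N}[\widetilde{\mathsf Q}]-\mathbb E_{\mathbb P_{\rm true}}[\widetilde{\mathsf Q}]=\frac1N\sum_{i=1}^N\widehat{\mathsf Q}_i-\mathbb E_{\mathbb P_{\rm true}}[\widetilde{\mathsf Q}].$$ 1. If the $\widehat{\boldsymbol\xi}_i$ are sub-exponential and $K:=\max_i\|\widehat{\boldsymbol\xi}_i\|_{\psi_1}$, then with probability at least $1-\beta$ $$\sup_{\mathbf y\in\mathbb S^{n-1}}\mathbf y^\top\mathsf D\,\mathbf y\le CK\left(\sqrt{\frac{m+\log(2/\beta)}N}+\frac{m+\log(2/\beta)}N\right).$$ 2. If the $\widehat{\boldsymbol\xi}_i$ are sub-exponential and $R>0$ satisfies $\big\|\,\|\widehat{\boldsymbol\xi}_i\|_2\,\big\|_{\psi_1}\le R$ for all $i$, then with probability at least $1-\beta$ $$\sup_{\mathbf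 y\in\mathbb S^{n-1}}\mathbf y^\top\mathsf D\,\mathbf y\le 2\sqrt2\,R\sqrt{\frac{2\log(2/\beta)}N}+\frac{R\log(2/\beta)}N.$$ 3. If the $\widehat{\boldsymbol\xi}_i$ are sub-Gaussian and $K:=\max_i\|\widehat{\boldsymbol\xi}_i\|_{\psi_2}$, then with probability at least $1-\beta$ $$\sup_{\mathbf y\in\mathbb S^{n-1}}\mathbf y^\top\mathsf D\,\mathbf y\le CK\left(\sqrt{\frac mN}+\sqrt{\frac{\log(2/\beta)}N}\right).$$ In particular, in each case the same bound holds, with probability at least $1-\beta$, for $\mathbf y^\top\mathsf D\,\mathbf y$ at every fixed $\mathbf y\in\mathbb S^{n-1}$. -/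

import Mathlib

open MeasureTheory ProbabilityTheory
open scoped ENNReal

noncomputable section

/-- The space `𝒮ⁿ` of real symmetric `n × n` matrices. -/
def SymMat (n : ℕ) : Type :=
  {A : Matrix (Fin n) (Fin n) ℝ // A.IsSymm}

/-- The Borel σ-algebra of `𝒮ⁿ`, generated by the matrix entries. -/
instance SymMat.instMeasurableSpace (n : ℕ) : MeasurableSpace (SymMat n) :=
  MeasurableSpace.comap (fun (A : SymMat n) (i j : Fin n) => A.1 i j) inferInstance

/-- The `n(n+1)/2` positions on and above the diagonal of an `n × n` matrix. -/
abbrev UpperIdx (n : ℕ) : Type :=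
  {p : Fin n × Fin n // p.1 ≤ p.2}

/-- Symmetric vectorization: diagonal entries are kept, off-diagonal entries are multiplied
by `√2`. The coordinates of `ℝᵐ`, `m = n(n+1)/2`, are labelled by the positions on and above
the diagonal. -/
def svec {n : ℕ} (A : SymMat n) : EuclideanSpace ℝ (UpperIdx n) :=
  WithLp.toLp 2 fun p =>
    if p.1.1 = p.1.2 then A.1 p.1.1 p.1.2 else Real.sqrt 2 * A.1 p.1.1 p.1.2

/-- The Orlicz norm `‖X‖_{ψ_q} = inf {t > 0 : 𝔼 exp (|X|^q / t^q) ≤ 2}` of a real random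
variable, with value `∞` if there is no such `t`; `q = 1` is the sub-exponential norm and
`q = 2` the sub-Gaussian norm. -/
def psiNorm {Ω : Type*} [MeasurableSpace Ω] (q : ℕ) (X : Ω → ℝ) (μ : Measure Ω) : ℝ≥0∞ :=
  ⨅ (t : ℝ) (_ : 0 < t) (_ : ∫⁻ ω, ENNReal.ofReal (Real.exp (|X ω| ^ q / t ^ q)) ∂μ ≤ 2),
    ENNReal.ofReal t

/-- The norm `‖ξ‖_{ψ_q} = sup_{‖y‖₂ = 1} ‖yᵀξ‖_{ψ_q}` of a random vector. -/
def psiNormVec {Ω ι : Type*} [MeasurableSpace Ω] [Fintype ι] (q : ℕ)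
    (ξ : Ω → EuclideanSpace ℝ ι) (μ : Measure Ω) : ℝ≥0∞ :=
  ⨆ y : Metric.sphere (0 : EuclideanSpace ℝ ι) 1,
    psiNorm q (fun ω => inner ℝ (y : EuclideanSpace ℝ ι) (ξ ω)) μ

/-- A random vector is sub-exponential if its `ψ₁`-norm is finite. -/
def IsSubExponentialVec {Ω ι : Type*} [MeasurableSpace Ω] [Fintype ι]
    (ξ : Ω → EuclideanSpace ℝ ι) (μ : Measure Ω) : Prop :=
  psiNormVec 1 ξ μ < ∞

/-- A random vector is sub-Gaussian if its `ψ₂`-norm is finite. -/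
def IsSubGaussianVec {Ω ι : Type*} [MeasurableSpace Ω] [Fintype ι]
    (ξ : Ω → EuclideanSpace ℝ ι) (μ : Measure Ω) : Prop :=
  psiNormVec 2 ξ μ < ∞

/-- The expectation `𝔼_P[Q̃]` of a random symmetric matrix `Q̃` with distribution `P`, taken
entry by entry. -/
def meanMat {n : ℕ} (P : Measure (SymMat n)) : Matrix (Fin n) (Fin n) ℝ :=
  Matrix.of fun i j => ∫ A : SymMat n, A.1 i j ∂P

/-- The empirical distribution `P̂_N = (1/N) ∑ᵢ δ_{Qᵢ}` of a sample of symmetric matrices. -/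
def empiricalDist {n N : ℕ} (Q : Fin N → SymMat n) : Measure (SymMat n) :=
  (N : ℝ≥0∞)⁻¹ • ∑ i, Measure.dirac (Q i)

/-- The quadratic form `yᵀ A y`. -/
def quadForm {n : ℕ} (A : Matrix (Fin n) (Fin n) ℝ) (y : EuclideanSpace ℝ (Fin n)) : ℝ :=
  ∑ i, ∑ j, y i * A i j * y j

end

/-! Since `svec` is an isometry for the Frobenius inner product, yᵀDy = ⟨svec(yyᵀ), svec D⟩ with
svec(yyᵀ) a unit vector. Hence every quadratic form, and their supremum, is at most ‖svec D‖ =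
‖∑ᵢ(ξᵢ − 𝔼ξᵢ)‖ / N, and only the tail of this norm has to be bounded.

When the norms ‖ξᵢ‖ are sub-exponential, a Chernoff argument runs directly in Hilbert space with
cosh‖·‖ in place of the exponential. By `cosh_norm_add_le`, adding an independent centered Y
multiplies 𝔼 cosh‖·‖ by at most 1 + 𝔼(exp‖Y‖ − 1 − ‖Y‖), because the first-order term averages to
zero. The result, `measureReal_norm_sum_sub_integral_gt_le`, does not involve the dimension.

When only the marginals are controlled, a net of at most 5ᵐ unit vectors reduces the norm to
one-dimensional tails: the same Bernstein inequality on ℝ, or Hoeffding's inequality for centered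
sub-Gaussian variables. A deviation level L = 2(m + log(2/β)) pays for the union bound.

The ψ-norms are infima, so each tail is proved for every K' > K and passed to K by continuity of the
measure; this also covers K = 0. -/

/-! ### Smoothness of cosh‖·‖ in an inner product space -/

/-- `u ↦ cosh √u` lies below its chords on `[0, ∞)`. -/
lemma cosh_sqrt_le_chord {u v w : ℝ} (hu : 0 ≤ u) (hv : 0 ≤ v) (hw0 : 0 ≤ w) (hw1 : w ≤ 1) :
    Real.cosh (√(w * u + (1 - w) * v)) ≤
      w * Real.cosh (√u) + (1 - w) * Real.cosh (√v) := by
  -- cosh √u = ∑ uᵏ/(2k)!, and each power uᵏ is convex on [0, ∞).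
  refine hasSum_le (fun k => ?_) (Real.hasSum_cosh _)
    (((Real.hasSum_cosh (√u)).mul_left w).add ((Real.hasSum_cosh (√v)).mul_left (1 - w)))
  have h1w : 0 ≤ 1 - w := sub_nonneg.2 hw1
  rw [pow_mul, pow_mul, pow_mul, Real.sq_sqrt (by positivity), Real.sq_sqrt hu, Real.sq_sqrt hv]
  have h := (convexOn_pow (𝕜 := ℝ) k).2 hu hv hw0 h1w (by ring)
  simp only [smul_eq_mul] at h
  rw [← mul_div_assoc, ← mul_div_assoc, ← add_div]
  gcongr

/-- A second-order upper bound for `cosh ‖·‖` in an inner product space. -/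
lemma cosh_norm_add_le {H : Type*} [NormedAddCommGroup H] [InnerProductSpace ℝ H] (x y : H) :
    Real.cosh ‖x + y‖ ≤ Real.cosh ‖x‖ + inner ℝ ((Real.sinh ‖x‖ / ‖x‖) • x) y +
      Real.cosh ‖x‖ * (Real.exp ‖y‖ - 1 - ‖y‖) := by
  rw [real_inner_smul_left]
  have hexp : Real.exp ‖y‖ = Real.cosh ‖y‖ + Real.sinh ‖y‖ := (Real.cosh_add_sinh _).symm
  rcases eq_or_ne x 0 with rfl | hx
  · have := Real.self_le_sinh_iff.2 (norm_nonneg y)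
    simp only [zero_add, norm_zero, Real.cosh_zero, inner_zero_left, mul_zero, hexp]
    linarith
  rcases eq_or_ne y 0 with rfl | hy
  · simp
  have ha : 0 < ‖x‖ := norm_pos_iff.2 hx
  have hb : 0 < ‖y‖ := norm_pos_iff.2 hy
  have hc := abs_le.1 (abs_real_inner_le_norm x y)
  set a := ‖x‖
  set b := ‖y‖
  set c := inner ℝ x y
  have hab : 0 < a * b := mul_pos ha hb
  -- This weight makes ‖x + y‖² = a² + 2c + b² equal to w(a + b)² + (1 − w)(a − b)²; Cauchy–Schwarz
  -- puts it in [0, 1].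
  set w := (1 + c / (a * b)) / 2 with hw
  have hcw : c = (2 * w - 1) * (a * b) := by rw [hw]; field_simp; ring
  have hw0 : 0 ≤ w := by
    by_contra h
    nlinarith
  have hw1 : w ≤ 1 := by
    by_contra h
    nlinarith
  have hnorm : ‖x + y‖ = √(w * (a + b) ^ 2 + (1 - w) * (a - b) ^ 2) := by
    rw [eq_comm, Real.sqrt_eq_iff_mul_self_eq (by nlinarith [sq_nonneg (a + b), sq_nonneg (a - b)])
      (norm_nonneg _), ← sq, norm_add_sq_real]
    change _ = a ^ 2 + 2 * c + b ^ 2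
    rw [hcw]; ring
  have hchord := cosh_sqrt_le_chord (sq_nonneg (a + b)) (sq_nonneg (a - b)) hw0 hw1
  rw [← hnorm, Real.sqrt_sq (by positivity), Real.sqrt_sq_eq_abs, Real.cosh_abs, Real.cosh_add,
    Real.cosh_sub] at hchord
  have hs : b ≤ Real.sinh b := Real.self_le_sinh_iff.2 hb.le
  have hsa : 0 ≤ Real.sinh a := Real.sinh_nonneg_iff.2 ha.le
  have hsc : Real.sinh a ≤ Real.cosh a := (Real.sinh_lt_cosh a).le
  have hinner : Real.sinh a / a * c = (2 * w - 1) * b * Real.sinh a := by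
    rw [hcw]; field_simp
  rw [hinner, hexp]
  have h1 : (2 * w - 1) * (Real.sinh b - b) * Real.sinh a ≤
      (Real.sinh b - b) * Real.cosh a := by
    have : 0 ≤ (Real.sinh b - b) := by linarith
    calc (2 * w - 1) * (Real.sinh b - b) * Real.sinh a ≤ 1 * (Real.sinh b - b) * Real.sinh a := by
          gcongr; linarith
      _ ≤ _ := by rw [one_mul]; gcongr
  nlinarith

/-- The power series of exp z − 1 − z starts in degree two, so every term gains at least a factor
s². -/
lemma exp_mul_sub_le {s x : ℝ} (hs0 : 0 ≤ s) (hs1 : s ≤ 1) (hx : 0 ≤ x) :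
    Real.exp (s * x) - 1 - s * x ≤ s ^ 2 * (Real.exp x - 1 - x) := by
  have hexp (z : ℝ) : HasSum (fun k : ℕ => z ^ (k + 2) / (k + 2).factorial)
      (Real.exp z - 1 - z) := by
    have h := NormedSpace.expSeries_div_hasSum_exp (𝔸 := ℝ) z
    rw [← Real.exp_eq_exp_ℝ] at h
    have := (hasSum_nat_add_iff' 2).2 h
    simpa [Finset.sum_range_succ, sub_sub] using this
  refine hasSum_le (fun k => ?_) (hexp _) ((hexp x).mul_left (s ^ 2))
  rw [← mul_div_assoc, mul_pow, pow_add s k 2]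
  gcongr
  exact mul_le_of_le_one_left (by positivity) (pow_le_one₀ hs0 hs1)

/-! ### Nets of the sphere -/

/-- A net of the unit sphere of a finite-dimensional Euclidean space that determines the norm
up to a factor of two. -/
lemma exists_finset_norm_le_two_mul_inner (E : Type*) [NormedAddCommGroup E]
    [InnerProductSpace ℝ E] [FiniteDimensional ℝ E] :
    ∃ s : Finset E, s.card ≤ 5 ^ Module.finrank ℝ E ∧ (∀ z ∈ s, ‖z‖ = 1) ∧
      ∀ v : E, v ≠ 0 → ∃ z ∈ s, ‖v‖ ≤ 2 * inner ℝ z v := by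
  classical
  -- Radius 2 and separation 1 fit the volume bound 5ᵈ of `Besicovitch.card_le_of_separated`. A
  -- separated set of maximal cardinality is a net, and halving it lands on the unit sphere.
  let P : ℕ → Prop := fun k => ∃ s : Finset E, s.card = k ∧ (∀ c ∈ s, ‖c‖ = 2) ∧
    ∀ c ∈ s, ∀ d ∈ s, c ≠ d → 1 ≤ ‖c - d‖
  have hP : P 0 := ⟨∅, by simp⟩
  have hb : ∀ k, P k → k ≤ 5 ^ Module.finrank ℝ E := by
    rintro k ⟨s, rfl, hs, hsep⟩
    exact Besicovitch.card_le_of_separated s (fun c hc => (hs c hc).le) hsep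
  obtain ⟨s, hcard, hs, hsep⟩ := Nat.findGreatest_spec (P := P) (Nat.zero_le _) hP
  have hinj : Function.Injective fun c : E => (2⁻¹ : ℝ) • c :=
    smul_right_injective E (by norm_num)
  refine ⟨s.image fun c => (2⁻¹ : ℝ) • c, ?_, ?_, ?_⟩
  · rw [Finset.card_image_of_injective _ hinj, hcard]
    exact Nat.findGreatest_le _
  · intro z hz
    obtain ⟨c, hc, rfl⟩ := Finset.mem_image.1 hz
    rw [norm_smul, hs c hc]; norm_num
  · intro v hv
    have hv' : 0 < ‖v‖ := norm_pos_iff.2 hv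
    set d : E := (2 / ‖v‖) • v with hd
    have hdn : ‖d‖ = 2 := by
      rw [hd, norm_smul, Real.norm_of_nonneg (by positivity)]; field_simp
    obtain ⟨c, hc, hcd⟩ : ∃ c ∈ s, ‖c - d‖ ≤ 1 := by
      by_contra! hcon
      have hds : d ∉ s := fun h => by have := hcon d h; simp at this; linarith
      have hP' : P (s.card + 1) := by
        refine ⟨insert d s, Finset.card_insert_of_notMem hds, ?_, ?_⟩
        · intro c hc
          rcases Finset.mem_insert.1 hc with rfl | hc
          exacts [hdn, hs c hc]
        · intro c hc e he hce
          rcases Finset.mem_insert.1 hc with rfl | hc <;>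
            rcases Finset.mem_insert.1 he with rfl | he
          · exact absurd rfl hce
          · rw [norm_sub_rev]; exact (hcon e he).le
          · exact (hcon c hc).le
          · exact hsep c hc e he hce
      have := Nat.le_findGreatest (hb _ hP') hP'
      omega
    refine ⟨_, Finset.mem_image_of_mem _ hc, ?_⟩
    -- Two vectors of norm 2 at distance at most 1 have inner product at least 7/2, more than the
    -- factor of two requires.
    have h1 := norm_sub_sq_real c d
    rw [hs c hc, hdn] at h1
    have h2 : ‖c - d‖ ^ 2 ≤ 1 := by nlinarith [norm_nonneg (c - d)]
    have h3 : inner ℝ c d = 2 / ‖v‖ * inner ℝ c v := by rw [hd, real_inner_smul_right]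
    have h4 : 7 / 2 ≤ 2 / ‖v‖ * inner ℝ c v := by rw [← h3]; linarith
    rw [div_mul_eq_mul_div, le_div_iff₀ hv'] at h4
    rw [real_inner_smul_left]
    linarith

/-! ### Exponential moments and centering -/

lemma integrable_of_integrable_exp_norm {Ω H : Type*} [MeasurableSpace Ω] {μ : Measure Ω}
    [NormedAddCommGroup H] [MeasurableSpace H] [BorelSpace H] [SecondCountableTopology H]
    {X : Ω → H} (hX : AEMeasurable X μ)
    (h : Integrable (fun ω => Real.exp ‖X ω‖) μ) : Integrable X μ :=
  h.mono' hX.aestronglyMeasurable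
    (ae_of_all _ fun ω => by linarith [Real.add_one_le_exp ‖X ω‖])

lemma integrable_and_integral_le_of_lintegral_le {Ω : Type*} [MeasurableSpace Ω]
    {μ : Measure Ω} {f : Ω → ℝ} {c : ℝ} (hc : 0 ≤ c)
    (hf : AEMeasurable f μ)
    (h0 : ∀ ω, 0 ≤ f ω) (h : ∫⁻ ω, ENNReal.ofReal (f ω) ∂μ ≤ ENNReal.ofReal c) :
    Integrable f μ ∧ ∫ ω, f ω ∂μ ≤ c := by
  refine ⟨⟨hf.aestronglyMeasurable, ?_⟩, ?_⟩
  · rw [hasFiniteIntegral_iff_ofReal (ae_of_all _ h0)]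
    exact h.trans_lt ENNReal.ofReal_lt_top
  · rw [integral_eq_lintegral_of_nonneg_ae (ae_of_all _ h0) hf.aestronglyMeasurable]
    exact ENNReal.toReal_le_of_le_ofReal hc h

/-- Centering doubles the bound on the exponential moment of the norm. -/
lemma integral_exp_norm_sub_integral_le {Ω H : Type*} [MeasurableSpace Ω]
    {μ : Measure Ω} [IsProbabilityMeasure μ] [NormedAddCommGroup H] [InnerProductSpace ℝ H]
    [MeasurableSpace H] [BorelSpace H] [SecondCountableTopology H] {X : Ω → H} (hX : AEMeasurable X μ)
    (hi : Integrable (fun ω => Real.exp ‖X ω‖) μ) (h : ∫ ω, Real.exp ‖X ω‖ ∂μ ≤ 2) :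
    Integrable (fun ω => Real.exp ‖X ω - ∫ ω', X ω' ∂μ‖) μ ∧
      ∫ ω, Real.exp ‖X ω - ∫ ω', X ω' ∂μ‖ ∂μ ≤ 4 := by
  have hXi := integrable_of_integrable_exp_norm hX hi
  -- Jensen: exp‖𝔼X‖ ≤ exp 𝔼‖X‖ ≤ 𝔼 exp‖X‖ ≤ 2.
  have hJ : Real.exp ‖∫ ω', X ω' ∂μ‖ ≤ 2 := by
    refine (Real.exp_le_exp.2 (norm_integral_le_integral_norm _)).trans (le_trans ?_ h)
    exact convexOn_exp.map_integral_le Real.continuous_exp.continuousOn isClosed_univ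
      (by simp) hXi.norm hi
  have hle (ω : Ω) : Real.exp ‖X ω - ∫ ω', X ω' ∂μ‖ ≤ Real.exp ‖X ω‖ * 2 := by
    refine (Real.exp_le_exp.2 (norm_sub_le _ _)).trans ?_
    rw [Real.exp_add]
    gcongr
  have hint : Integrable (fun ω => Real.exp ‖X ω - ∫ ω', X ω' ∂μ‖) μ := by
    refine (hi.mul_const 2).mono' ?_ (ae_of_all _ fun ω => ?_)
    · exact (Real.measurable_exp.comp_aemeasurable
        (hX.sub_const _).norm).aestronglyMeasurable
    · rw [Real.norm_of_nonneg (Real.exp_pos _).le]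
      exact hle ω
  refine ⟨hint, (integral_mono hint (hi.mul_const 2) hle).trans ?_⟩
  rw [integral_mul_const]
  linarith

/-! ### Bernstein inequality in Hilbert space -/

section Hilbert

variable {Ω ι H : Type*} [MeasurableSpace Ω] {μ : Measure Ω} [IsProbabilityMeasure μ]
  [NormedAddCommGroup H] [InnerProductSpace ℝ H] [CompleteSpace H] [MeasurableSpace H]
  [BorelSpace H] [SecondCountableTopology H]

/-- Adding an independent centered vector multiplies the `cosh`-moment of the norm by at most
`1 + E (exp ‖Y‖ - 1 - ‖Y‖)`. -/
lemma integral_cosh_norm_add_le {W Y : Ω → H} (hWY : IndepFun W Y μ) (hW : AEMeasurable W μ)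
    (hY : AEMeasurable Y μ) (hWi : Integrable (fun ω => Real.cosh ‖W ω‖) μ)
    (hYi : Integrable (fun ω => Real.exp ‖Y ω‖) μ) (hY0 : ∫ ω, Y ω ∂μ = 0) :
    Integrable (fun ω => Real.cosh ‖W ω + Y ω‖) μ ∧
      ∫ ω, Real.cosh ‖W ω + Y ω‖ ∂μ ≤ (∫ ω, Real.cosh ‖W ω‖ ∂μ) *
        (1 + ∫ ω, (Real.exp ‖Y ω‖ - 1 - ‖Y ω‖) ∂μ) := by
  have hYint : Integrable Y μ := integrable_of_integrable_exp_norm hY hYi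
  -- The gradient of cosh‖·‖, also at 0, where the quotient 0 / 0 = 0 is harmless. Its norm sinh‖x‖
  -- ≤ cosh‖x‖ makes `g (W ω)` integrable.
  let g : H → H := fun x => (Real.sinh ‖x‖ / ‖x‖) • x
  have hg : Measurable g := by
    refine Measurable.smul (Measurable.div ?_ measurable_norm) measurable_id
    exact Real.continuous_sinh.measurable.comp measurable_norm
  have hgW : Integrable (fun ω => g (W ω)) μ := by
    refine hWi.mono' (hg.comp_aemeasurable hW).aestronglyMeasurable (ae_of_all _ fun ω => ?_)
    have h0 : 0 ≤ Real.sinh ‖W ω‖ := Real.sinh_nonneg_iff.2 (norm_nonneg _)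
    rw [norm_smul, Real.norm_of_nonneg (by positivity)]
    refine le_trans ?_ (Real.sinh_lt_cosh _).le
    rcases eq_or_ne ‖W ω‖ 0 with h | h
    · simp [h]
    · exact (div_mul_cancel₀ _ h).le
  have hind : IndepFun (fun ω => g (W ω)) Y μ := hWY.comp hg measurable_id
  -- By independence 𝔼⟨g(W), Y⟩ = ⟨𝔼 g(W), 𝔼Y⟩ = 0.
  have hB := hind.integrable_bilin hgW hYint (innerSL ℝ)
  have hB0 := hind.integral_bilin hgW hYint (innerSL ℝ)
  rw [hY0, map_zero] at hB0
  have hE : Integrable (fun ω => Real.exp ‖Y ω‖ - 1 - ‖Y ω‖) μ :=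
    (hYi.sub (integrable_const 1)).sub hYint.norm
  have hind2 : IndepFun (fun ω => Real.cosh ‖W ω‖)
      (fun ω => Real.exp ‖Y ω‖ - 1 - ‖Y ω‖) μ :=
    hWY.comp (φ := fun x => Real.cosh ‖x‖) (ψ := fun y => Real.exp ‖y‖ - 1 - ‖y‖)
      (by fun_prop) (by fun_prop)
  have hP := hind2.integrable_mul hWi hE
  have hsum := (hWi.add hB).add hP
  have hle (ω : Ω) := cosh_norm_add_le (W ω) (Y ω)
  have hint : Integrable (fun ω => Real.cosh ‖W ω + Y ω‖) μ := by
    refine hsum.mono' ?_ (ae_of_all _ fun ω => ?_)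
    · have : AEMeasurable (fun ω => Real.cosh ‖W ω + Y ω‖) μ :=
        Real.continuous_cosh.measurable.comp_aemeasurable (hW.add hY).norm
      exact this.aestronglyMeasurable
    · rw [Real.norm_of_nonneg (Real.cosh_pos _).le]
      exact hle ω
  refine ⟨hint, (integral_mono hint hsum hle).trans_eq ?_⟩
  rw [integral_add' (hWi.add hB) hP, integral_add' hWi hB, hB0,
    hind2.integral_mul_eq_mul_integral hWi.aestronglyMeasurable hE.aestronglyMeasurable]
  ring

/-- Exponential moment of the norm of a sum of independent centered random vectors. -/
lemma integral_cosh_norm_sum_le {Y : ι → Ω → H} (hind : iIndepFun Y μ)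
    (hY : ∀ i, AEMeasurable (Y i) μ) (hYi : ∀ i, Integrable (fun ω => Real.exp ‖Y i ω‖) μ)
    (hY0 : ∀ i, ∫ ω, Y i ω ∂μ = 0) {a : ℝ}
    (ha : ∀ i, ∫ ω, (Real.exp ‖Y i ω‖ - 1 - ‖Y i ω‖) ∂μ ≤ a) (s : Finset ι) :
    Integrable (fun ω => Real.cosh ‖∑ i ∈ s, Y i ω‖) μ ∧
      ∫ ω, Real.cosh ‖∑ i ∈ s, Y i ω‖ ∂μ ≤ Real.exp (s.card * a) := by
  classical
  induction s using Finset.induction_on with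
  | empty => simp
  | insert i s his ih =>
    have hi := (hind.indepFun_finsetSum_of_notMem₀ hY his)
    have heq : (∑ j ∈ s, Y j) = fun ω => ∑ j ∈ s, Y j ω := by ext ω; simp
    rw [heq] at hi
    have hstep := integral_cosh_norm_add_le hi
      (Finset.aemeasurable_fun_sum s fun j _ => hY j) (hY i) ih.1 (hYi i) (hY0 i)
    simp only [Finset.sum_insert his, Finset.card_insert_of_notMem his, add_comm (Y i _)]
    refine ⟨hstep.1, hstep.2.trans ?_⟩
    have h0 : 0 ≤ ∫ ω, (Real.exp ‖Y i ω‖ - 1 - ‖Y i ω‖) ∂μ :=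
      integral_nonneg fun ω => by
        have := Real.add_one_le_exp ‖Y i ω‖
        simp only [Pi.zero_apply]; linarith
    calc _ ≤ Real.exp (s.card * a) * Real.exp a := by
          refine mul_le_mul ih.2 ?_ (by linarith) (Real.exp_pos _).le
          linarith [Real.add_one_le_exp a, ha i]
      _ = _ := by rw [← Real.exp_add]; push_cast; ring_nf

/-- The choice s = √(L/N)/2 balances 3Ns² against L and is admissible while L ≤ 4N; beyond that the
constraint s ≤ 1 binds and s = 1 works. The 3 is the second-order bound on the centered normalized
summands. -/
lemma exists_chernoff_parameter {N L : ℝ} (hN : 0 ≤ N) (hL : 0 ≤ L) :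
    ∃ s : ℝ, 0 ≤ s ∧ s ≤ 1 ∧ N * (s ^ 2 * 3) + L ≤ s * (4 * √(L * N) + L) := by
  rcases le_or_gt L (4 * N) with h | h
  · rcases hN.eq_or_lt with rfl | hN
    · exact ⟨1, by norm_num, le_rfl, by simp⟩
    have hdiv : √(L / N) ≤ 2 := by
      rw [Real.sqrt_le_left (by norm_num), div_le_iff₀ hN]; linarith
    refine ⟨√(L / N) / 2, by positivity, by linarith, ?_⟩
    have h1 : √(L / N) ^ 2 = L / N := Real.sq_sqrt (by positivity)
    have h2 : √(L / N) * √(L * N) = L := by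
      rw [← Real.sqrt_mul (by positivity), Real.sqrt_eq_iff_mul_self_eq (by positivity) hL]
      field_simp
    have h3 : N * ((√(L / N) / 2) ^ 2 * 3) = 3 / 4 * L := by
      rw [div_pow, h1]; field_simp; ring
    have h4 : 0 ≤ √(L / N) * L := by positivity
    rw [h3]
    nlinarith
  · refine ⟨1, by norm_num, le_rfl, ?_⟩
    have : N ≤ √(L * N) := Real.le_sqrt_of_sq_le (by nlinarith)
    linarith

/-- **Bernstein inequality in Hilbert space** for independent vectors whose norms are
sub-exponential. -/
theorem measureReal_norm_sum_sub_integral_gt_le [Fintype ι] {X : ι → Ω → H} (hind : iIndepFun X μ)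
    (hX : ∀ i, AEMeasurable (X i) μ) {R : ℝ} (hR : 0 < R)
    (h : ∀ i, ∫⁻ ω, ENNReal.ofReal (Real.exp (‖X i ω‖ / R)) ∂μ ≤ 2) {L : ℝ} (hL : 0 ≤ L) :
    μ.real {ω | R * (4 * √(L * Fintype.card ι) + L) < ‖∑ i, (X i ω - ∫ ω', X i ω' ∂μ)‖} ≤
      2 * Real.exp (-L) := by
  obtain ⟨s, hs0, hs1, hs⟩ := exists_chernoff_parameter (Nat.cast_nonneg (Fintype.card ι)) hL
  let Z : ι → Ω → H := fun i ω => R⁻¹ • (X i ω - ∫ ω', X i ω' ∂μ)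
  have hZm (i) : AEMeasurable (Z i) μ := ((hX i).sub_const _).const_smul _
  have hZ (i) : Integrable (fun ω => Real.exp ‖Z i ω‖) μ ∧ ∫ ω, Real.exp ‖Z i ω‖ ∂μ ≤ 4 := by
    have hm : AEMeasurable (fun ω => R⁻¹ • X i ω) μ := (hX i).const_smul _
    have hn (ω) : ‖R⁻¹ • X i ω‖ = ‖X i ω‖ / R := by
      rw [norm_smul, norm_inv, Real.norm_of_nonneg hR.le, inv_mul_eq_div]
    have h2 := integrable_and_integral_le_of_lintegral_le (μ := μ) (c := 2)
      (f := fun ω => Real.exp ‖R⁻¹ • X i ω‖) (by norm_num)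
      (Real.measurable_exp.comp_aemeasurable hm.norm) (fun ω => (Real.exp_pos _).le)
      (by simpa only [hn, ENNReal.ofReal_ofNat] using h i)
    have h3 := integral_exp_norm_sub_integral_le hm h2.1 h2.2
    simpa only [Z, smul_sub, integral_smul] using h3
  have hXi (i) : Integrable (X i) μ := by
    have := ((integrable_of_integrable_exp_norm (hZm i) (hZ i).1).smul R).add
      (integrable_const (∫ ω', X i ω' ∂μ))
    refine this.congr (ae_of_all _ fun ω => ?_)
    simp [Z, smul_inv_smul₀ hR.ne']
  let Y : ι → Ω → H := fun i ω => s • Z i ω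
  have hYm (i) : AEMeasurable (Y i) μ := (hZm i).const_smul _
  have hYn (i ω) : ‖Y i ω‖ = s * ‖Z i ω‖ := by
    rw [norm_smul, Real.norm_of_nonneg hs0]
  have hYi (i) : Integrable (fun ω => Real.exp ‖Y i ω‖) μ := by
    refine (hZ i).1.mono' (Real.measurable_exp.comp_aemeasurable
      (hYm i).norm).aestronglyMeasurable (ae_of_all _ fun ω => ?_)
    rw [Real.norm_of_nonneg (Real.exp_pos _).le, hYn]
    exact Real.exp_le_exp.2 (mul_le_of_le_one_left (norm_nonneg _) hs1)
  have hY0 (i) : ∫ ω, Y i ω ∂μ = 0 := by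
    simp [Y, Z, integral_smul, integral_sub (hXi i) (integrable_const _)]
  -- Here 3 = 4 − 1: centering raised the exponential moment from 2 to 4, and −‖Z‖ is dropped.
  have hYa (i) : ∫ ω, (Real.exp ‖Y i ω‖ - 1 - ‖Y i ω‖) ∂μ ≤ s ^ 2 * 3 := by
    have hb : Integrable (fun ω => s ^ 2 * (Real.exp ‖Z i ω‖ - 1)) μ :=
      ((hZ i).1.sub (integrable_const 1)).const_mul _
    calc _ ≤ ∫ ω, s ^ 2 * (Real.exp ‖Z i ω‖ - 1) ∂μ := by
          refine integral_mono (((hYi i).sub (integrable_const 1)).sub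
            (integrable_of_integrable_exp_norm (hYm i) (hYi i)).norm) hb fun ω => ?_
          simp only [hYn]
          refine (exp_mul_sub_le hs0 hs1 (norm_nonneg _)).trans ?_
          exact mul_le_mul_of_nonneg_left (by linarith [norm_nonneg (Z i ω)]) (sq_nonneg s)
      _ ≤ _ := by
          rw [integral_const_mul, integral_sub (hZ i).1 (integrable_const 1)]
          simp only [integral_const, probReal_univ, smul_eq_mul, mul_one]
          gcongr
          linarith [(hZ i).2]
  have hYind : iIndepFun Y μ :=
    hind.comp (fun i x => s • R⁻¹ • (x - ∫ ω', X i ω' ∂μ)) fun i => by fun_prop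
  obtain ⟨hc, hcle⟩ := integral_cosh_norm_sum_le hYind hYm hYi hY0 hYa Finset.univ
  -- Passing from exp to 2 cosh costs the prefactor 2 of the tail; Markov's inequality then applies
  -- to cosh.
  have hsub : {ω | R * (4 * √(L * Fintype.card ι) + L) < ‖∑ i, (X i ω - ∫ ω', X i ω' ∂μ)‖} ⊆
      {ω | Real.exp (s * (4 * √(L * Fintype.card ι) + L)) ≤
        2 * Real.cosh ‖∑ i, Y i ω‖} := by
    intro ω hω
    simp only [Set.mem_ofPred_eq] at hω ⊢
    have hS : ‖∑ i, Y i ω‖ = s * (‖∑ i, (X i ω - ∫ ω', X i ω' ∂μ)‖ / R) := by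
      simp only [Y, Z, ← Finset.smul_sum]
      rw [norm_smul, norm_smul, norm_inv, Real.norm_of_nonneg hs0, Real.norm_of_nonneg hR.le]
      ring
    calc _ ≤ Real.exp ‖∑ i, Y i ω‖ := by
          rw [hS]
          gcongr
          rw [le_div_iff₀ hR, mul_comm]
          exact hω.le
      _ ≤ _ := by
          rw [Real.cosh_eq]
          linarith [Real.exp_pos (-‖∑ i, Y i ω‖)]
  refine (measureReal_mono hsub).trans ?_
  have hM := mul_meas_ge_le_integral_of_nonneg (μ := μ)
    (ae_of_all _ fun ω => mul_nonneg zero_le_two (Real.cosh_pos ‖∑ i, Y i ω‖).le)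
    (hc.const_mul 2) (Real.exp (s * (4 * √(L * Fintype.card ι) + L)))
  rw [integral_const_mul] at hM
  rw [← le_div_iff₀' (Real.exp_pos _)] at hM
  refine hM.trans ?_
  rw [div_le_iff₀ (Real.exp_pos _), mul_assoc, ← Real.exp_add]
  refine mul_le_mul_of_nonneg_left (hcle.trans (Real.exp_le_exp.2 ?_)) zero_le_two
  rw [Finset.card_univ]
  linarith

end Hilbert

/-! ### Scalar sub-Gaussian variables -/

lemma exp_mul_le_of_abs_le_one {s y : ℝ} (hs : |s| ≤ 1) :
    Real.exp (s * y) ≤ 1 + s * y + s ^ 2 * Real.exp |y| := by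
  have habs : Real.exp (s * y) - 1 - s * y ≤ Real.exp |s * y| - 1 - |s * y| := by
    rcases le_total 0 (s * y) with h | h
    · rw [abs_of_nonneg h]
    · rw [abs_of_nonpos h]
      have h1 := Real.self_le_sinh_iff.2 (neg_nonneg.2 h)
      rw [Real.sinh_eq, neg_neg] at h1
      linarith
  have h2 := exp_mul_sub_le (abs_nonneg s) hs (abs_nonneg y)
  rw [sq_abs, ← abs_mul] at h2
  nlinarith [abs_nonneg y, sq_nonneg s]

/-- A random variable with `E exp (X²) ≤ 2` is sub-Gaussian after centering. -/
lemma hasSubgaussianMGF_sub_integral_of_integral_exp_sq_le {Ω : Type*} [MeasurableSpace Ω]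
    {μ : Measure Ω} [IsProbabilityMeasure μ] {X : Ω → ℝ} (hX : AEMeasurable X μ)
    (hi : Integrable (fun ω => Real.exp (X ω ^ 2)) μ) (h : ∫ ω, Real.exp (X ω ^ 2) ∂μ ≤ 2) :
    HasSubgaussianMGF (fun ω => X ω - ∫ ω', X ω' ∂μ) 30 μ := by
  have habs (ω : Ω) : |X ω| ≤ Real.exp (X ω ^ 2) / 2 := by
    have h1 := Real.add_one_le_exp (X ω ^ 2)
    rw [← sq_abs] at h1 ⊢
    nlinarith [sq_nonneg (|X ω| - 1)]
  have hXi : Integrable X μ :=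
    (hi.div_const 2).mono' hX.aestronglyMeasurable (ae_of_all _ habs)
  have hmean : |∫ ω, X ω ∂μ| ≤ 1 := by
    refine abs_integral_le_integral_abs.trans
      ((integral_mono hXi.abs (hi.div_const 2) habs).trans ?_)
    rw [integral_div]
    linarith
  set e := ∫ ω, X ω ∂μ
  have hbound (s : ℝ) (ω : Ω) :
      Real.exp (s * (X ω - e)) ≤ Real.exp (s ^ 2 / 4 + |s|) * Real.exp (X ω ^ 2) := by
    rw [← Real.exp_add]
    refine Real.exp_le_exp.2 ?_
    have h1 : -(s * e) ≤ |s| := by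
      refine (neg_le_abs _).trans ?_
      rw [abs_mul]
      exact mul_le_of_le_one_right (abs_nonneg s) hmean
    nlinarith [sq_nonneg (s / 2 - X ω)]
  have hint (s : ℝ) : Integrable (fun ω => Real.exp (s * (X ω - e))) μ := by
    refine (hi.const_mul (Real.exp (s ^ 2 / 4 + |s|))).mono' ?_ (ae_of_all _ fun ω => ?_)
    · exact (Real.measurable_exp.comp_aemeasurable
        ((hX.sub_const e).const_mul s)).aestronglyMeasurable
    · rw [Real.norm_of_nonneg (Real.exp_pos _).le]
      exact hbound s ω
  have he : Real.exp 1 < 2.72 := lt_trans Real.exp_one_lt_d9 (by norm_num)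
  refine ⟨hint, fun s => ?_⟩
  simp only [mgf, NNReal.coe_ofNat]
  -- For |s| ≤ 1 the vanishing mean kills the linear term, leaving 1 + 7.5 · 2 s² = 1 + 30s²/2; this
  -- case fixes the constant 30. For |s| > 1, Young's inequality is enough, as s²/4 + |s| + 1 ≤
  -- 15s².
  rcases le_or_gt |s| 1 with hs | hs
  · have hb (ω : Ω) : Real.exp |X ω - e| ≤ 7.5 * Real.exp (X ω ^ 2) := by
      have h2 : Real.exp 2 ≤ 7.5 := by
        rw [show (2 : ℝ) = 1 + 1 by norm_num, Real.exp_add]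
        nlinarith [Real.exp_pos 1]
      calc Real.exp |X ω - e| ≤ Real.exp (2 + X ω ^ 2) := by
            refine Real.exp_le_exp.2 ((abs_sub _ _).trans ?_)
            rw [← sq_abs (X ω)]
            nlinarith [sq_nonneg (|X ω| - 1 / 2)]
        _ ≤ _ := by rw [Real.exp_add]; gcongr
    have hYi : Integrable (fun ω => X ω - e) μ := hXi.sub (integrable_const e)
    have hY0 : ∫ ω, (X ω - e) ∂μ = 0 := by
      rw [integral_sub hXi (integrable_const e)]
      simp [e]
    have hU : Integrable
        (fun ω => 1 + s * (X ω - e) + s ^ 2 * (7.5 * Real.exp (X ω ^ 2))) μ :=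
      ((integrable_const 1).add (hYi.const_mul s)).add ((hi.const_mul _).const_mul _)
    calc ∫ ω, Real.exp (s * (X ω - e)) ∂μ
        ≤ ∫ ω, (1 + s * (X ω - e) + s ^ 2 * (7.5 * Real.exp (X ω ^ 2))) ∂μ := by
          refine integral_mono (hint s) hU fun ω => (exp_mul_le_of_abs_le_one hs).trans ?_
          gcongr
          exact hb ω
      _ = 1 + s ^ 2 * (7.5 * ∫ ω, Real.exp (X ω ^ 2) ∂μ) := by
          have h1 : Integrable (fun ω => 1 + s * (X ω - e)) μ :=
            (integrable_const 1).add (hYi.const_mul s)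
          rw [integral_add h1 ((hi.const_mul _).const_mul _), integral_add (integrable_const 1) (hYi.const_mul s),
            integral_const_mul, hY0, integral_const_mul, integral_const_mul]
          simp
      _ ≤ 30 * s ^ 2 / 2 + 1 := by nlinarith [sq_nonneg s]
      _ ≤ _ := Real.add_one_le_exp _
  · calc ∫ ω, Real.exp (s * (X ω - e)) ∂μ
        ≤ ∫ ω, Real.exp (s ^ 2 / 4 + |s|) * Real.exp (X ω ^ 2) ∂μ :=
          integral_mono (hint s) (hi.const_mul _) (hbound s)
      _ ≤ Real.exp (s ^ 2 / 4 + |s|) * Real.exp 1 := by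
          rw [integral_const_mul]
          gcongr
          linarith [Real.add_one_le_exp (1 : ℝ)]
      _ ≤ _ := by
          rw [← Real.exp_add]
          refine Real.exp_le_exp.2 ?_
          rw [← sq_abs s]
          nlinarith

/-- A real random variable with `E exp (X² / K²) ≤ 2` is sub-Gaussian after centering. -/
lemma hasSubgaussianMGF_sub_integral_of_lintegral_le {Ω : Type*} [MeasurableSpace Ω]
    {μ : Measure Ω} [IsProbabilityMeasure μ] {X : Ω → ℝ} (hX : AEMeasurable X μ) {K : ℝ}
    (hK : 0 < K) (h : ∫⁻ ω, ENNReal.ofReal (Real.exp (|X ω| ^ 2 / K ^ 2)) ∂μ ≤ 2) :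
    HasSubgaussianMGF (fun ω => X ω - ∫ ω', X ω' ∂μ) (Real.toNNReal (30 * K ^ 2)) μ := by
  have hm : AEMeasurable (fun ω => X ω / K) μ := hX.div_const K
  have h2 := integrable_and_integral_le_of_lintegral_le (μ := μ) (c := 2)
    (f := fun ω => Real.exp ((X ω / K) ^ 2)) (by norm_num)
    (Real.measurable_exp.comp_aemeasurable (hm.pow_const 2)) (fun ω => (Real.exp_pos _).le)
    (by simpa only [sq_abs, div_pow, ENNReal.ofReal_ofNat] using h)
  have h3 := (hasSubgaussianMGF_sub_integral_of_integral_exp_sq_le hm h2.1 h2.2).const_mul K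
  convert h3 using 1
  · ext ω
    simp only [integral_div]
    field_simp
  · refine NNReal.eq ?_
    rw [Real.coe_toNNReal _ (by positivity), mul_comm]
    rfl

/-! ### From one-dimensional tails to the norm -/

/-- Tail bounds in every fixed direction give a tail bound for the norm. -/
lemma measureReal_norm_gt_le_of_forall_inner {Ω E : Type*} [MeasurableSpace Ω] {μ : Measure Ω}
    [IsProbabilityMeasure μ] [NormedAddCommGroup E] [InnerProductSpace ℝ E]
    [FiniteDimensional ℝ E] {S : Ω → E} {t p : ℝ} (ht : 0 ≤ t)
    (hp : 0 ≤ p) (h : ∀ z : E, ‖z‖ = 1 → μ.real {ω | t < inner ℝ z (S ω)} ≤ p) :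
    μ.real {ω | 2 * t < ‖S ω‖} ≤ 5 ^ Module.finrank ℝ E * p := by
  obtain ⟨s, hcard, hs, hnet⟩ := exists_finset_norm_le_two_mul_inner E
  have hsub : {ω | 2 * t < ‖S ω‖} ⊆ ⋃ z ∈ s, {ω | t < inner ℝ z (S ω)} := by
    intro ω hω
    rw [Set.mem_ofPred_eq] at hω
    obtain ⟨z, hz, hle⟩ := hnet (S ω) (norm_pos_iff.1 (by linarith))
    refine Set.mem_biUnion hz ?_
    rw [Set.mem_ofPred_eq]
    linarith
  calc μ.real {ω | 2 * t < ‖S ω‖} ≤ ∑ z ∈ s, μ.real {ω | t < inner ℝ z (S ω)} :=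
        (measureReal_mono hsub (measure_ne_top _ _)).trans (measureReal_biUnion_finset_le _ _)
    _ ≤ s.card * p := by
        rw [← nsmul_eq_mul]
        exact Finset.sum_le_card_nsmul _ _ _ fun z hz => h z (hs z hz)
    _ ≤ _ := by
        gcongr
        exact_mod_cast hcard

lemma inner_sum_sub_integral {Ω ι E : Type*} [MeasurableSpace Ω] {μ : Measure Ω}
    [NormedAddCommGroup E] [InnerProductSpace ℝ E] [CompleteSpace E] [Fintype ι]
    {X : ι → Ω → E} (hX : ∀ i, Integrable (X i) μ) (z : E) (ω : Ω) :
    inner ℝ z (∑ i, (X i ω - ∫ ω', X i ω' ∂μ)) =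
      ∑ i, (inner ℝ z (X i ω) - ∫ ω', inner ℝ z (X i ω') ∂μ) := by
  rw [inner_sum]
  refine Finset.sum_congr rfl fun i _ => ?_
  rw [inner_sub_right, integral_inner (hX i)]

section FiniteDimensional

variable {Ω ι E : Type*} [MeasurableSpace Ω] {μ : Measure Ω} [IsProbabilityMeasure μ]
  [NormedAddCommGroup E] [InnerProductSpace ℝ E] [FiniteDimensional ℝ E] [MeasurableSpace E]
  [BorelSpace E] [Fintype ι]

theorem measureReal_norm_sum_gt_le_of_subexponential {X : ι → Ω → E} (hind : iIndepFun X μ)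
    (hX : ∀ i, Integrable (X i) μ) {K : ℝ} (hK : 0 < K)
    (h : ∀ i, ∀ z : E, ‖z‖ = 1 →
      ∫⁻ ω, ENNReal.ofReal (Real.exp (|inner ℝ z (X i ω)| / K)) ∂μ ≤ 2)
    {L : ℝ} (hL : 0 ≤ L) :
    μ.real {ω | 2 * (K * (4 * √(L * Fintype.card ι) + L)) <
      ‖∑ i, (X i ω - ∫ ω', X i ω' ∂μ)‖} ≤
      5 ^ Module.finrank ℝ E * (2 * Real.exp (-L)) := by
  refine measureReal_norm_gt_le_of_forall_inner (by positivity) (by positivity) fun z hz => ?_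
  have hi : iIndepFun (fun i ω => inner ℝ z (X i ω)) μ :=
    hind.comp (fun _ x => inner ℝ z x) fun _ => by fun_prop
  refine le_trans (measureReal_mono fun ω hω => ?_)
    (measureReal_norm_sum_sub_integral_gt_le hi
      (fun i => ((hX i).const_inner z).aemeasurable) hK (fun i => h i z hz) hL)
  rw [Set.mem_ofPred_eq] at hω ⊢
  have := FiniteDimensional.complete ℝ E
  rw [inner_sum_sub_integral hX] at hω
  exact hω.trans_le (le_abs_self _)

theorem measureReal_norm_sum_gt_le_of_subgaussian {X : ι → Ω → E} (hind : iIndepFun X μ)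
    (hX : ∀ i, Integrable (X i) μ) {K : ℝ} (hK : 0 < K)
    (h : ∀ i, ∀ z : E, ‖z‖ = 1 →
      ∫⁻ ω, ENNReal.ofReal (Real.exp (|inner ℝ z (X i ω)| ^ 2 / K ^ 2)) ∂μ ≤ 2)
    {L : ℝ} (hL : 0 ≤ L) [Nonempty ι] :
    μ.real {ω | 2 * (K * √(60 * L * Fintype.card ι)) <
      ‖∑ i, (X i ω - ∫ ω', X i ω' ∂μ)‖} ≤
      5 ^ Module.finrank ℝ E * Real.exp (-L) := by
  refine measureReal_norm_gt_le_of_forall_inner (by positivity) (by positivity) fun z hz => ?_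
  have hi : iIndepFun (fun i ω => inner ℝ z (X i ω) - ∫ ω', inner ℝ z (X i ω') ∂μ) μ :=
    hind.comp (fun i x => inner ℝ z x - ∫ ω', inner ℝ z (X i ω') ∂μ) fun _ => by fun_prop
  -- The variance proxies add up to 30K²N, so this ε has exponent ε² / (2 · 30K²N) = L.
  have hH := HasSubgaussianMGF.measure_sum_ge_le_of_iIndepFun hi (s := Finset.univ)
    (fun i _ => hasSubgaussianMGF_sub_integral_of_lintegral_le
      ((hX i).const_inner z).aemeasurable hK (h i z hz))
    (ε := K * √(60 * L * Fintype.card ι)) (by positivity)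
  refine le_trans (measureReal_mono fun ω hω => ?_) (hH.trans_eq ?_)
  · rw [Set.mem_ofPred_eq] at hω ⊢
    have := FiniteDimensional.complete ℝ E
    rw [inner_sum_sub_integral hX] at hω
    exact hω.le
  · have hc : (Fintype.card ι : ℝ) ≠ 0 := Nat.cast_ne_zero.2 Fintype.card_ne_zero
    congr 1
    rw [mul_pow, Real.sq_sqrt (by positivity)]
    simp only [Finset.sum_const, Finset.card_univ, nsmul_eq_mul, NNReal.coe_mul,
      NNReal.coe_natCast, Real.coe_toNNReal _ (show 0 ≤ 30 * K ^ 2 by positivity)]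
    field_simp
    ring

end FiniteDimensional

/-! ### Symmetric vectorization and the empirical mean -/

lemma card_upperIdx (n : ℕ) : (Fintype.card (UpperIdx n) : ℝ) = (n : ℝ) * (n + 1) / 2 := by
  rw [← Fintype.card_congr (Sym2.sortEquiv (α := Fin n)), Sym2.card, Fintype.card_fin,
    Nat.cast_choose_two]
  push_cast
  ring

lemma sum_upperIdx_of_symm {n : ℕ} (F : Fin n → Fin n → ℝ) (hF : ∀ i j, F i j = F j i) :
    ∑ p : UpperIdx n, (if p.1.1 = p.1.2 then F p.1.1 p.1.2 else 2 * F p.1.1 p.1.2) =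
      ∑ i, ∑ j, F i j := by
  rw [← Fintype.sum_prod_type' (f := F),
    ← Finset.sum_filter_add_sum_filter_not Finset.univ (fun p : Fin n × Fin n => p.1 ≤ p.2)]
  have hswap : ∑ p : Fin n × Fin n with ¬ p.1 ≤ p.2, F p.1 p.2 =
      ∑ p : Fin n × Fin n with p.1 < p.2, F p.1 p.2 :=
    Finset.sum_nbij' Prod.swap Prod.swap (by simp) (by simp) (by simp) (by simp)
      (fun p _ => hF _ _)
  have hlt : ∑ p : Fin n × Fin n with p.1 < p.2, F p.1 p.2 =
      ∑ p : Fin n × Fin n with p.1 ≤ p.2, if p.1 = p.2 then 0 else F p.1 p.2 := by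
    rw [Finset.sum_filter, Finset.sum_filter]
    refine Finset.sum_congr rfl fun p _ => ?_
    rcases lt_trichotomy p.1 p.2 with h | h | h
    · simp [h, h.le, h.ne]
    · simp [h]
    · simp [h.not_ge, h.not_gt]
  rw [hswap, hlt, ← Finset.sum_add_distrib,
    Finset.sum_subtype (p := fun p : Fin n × Fin n => p.1 ≤ p.2) _ (by simp)]
  refine Finset.sum_congr rfl fun p _ => ?_
  split_ifs <;> ring

/-- Each off-diagonal pair occurs once in `svec` but twice in the matrix; the weight (√2)² = 2
compensates. -/
lemma inner_svec {n : ℕ} (A B : SymMat n) :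
    inner ℝ (svec A) (svec B) = ∑ i, ∑ j, A.1 i j * B.1 i j := by
  rw [← sum_upperIdx_of_symm _ fun i j => by rw [A.2.apply i j, B.2.apply i j],
    PiLp.inner_apply]
  refine Finset.sum_congr rfl fun p _ => ?_
  simp only [svec, RCLike.inner_apply, conj_trivial]
  split_ifs
  · ring
  · linear_combination (A.1 p.1.1 p.1.2 * B.1 p.1.1 p.1.2) * Real.mul_self_sqrt (zero_le_two)

/-- The rank-one matrix `y yᵀ`. -/
def rankOne {n : ℕ} (y : EuclideanSpace ℝ (Fin n)) : SymMat n :=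
  ⟨Matrix.of fun i j => y i * y j, by ext i j; simp [mul_comm]⟩

lemma quadForm_eq_inner_svec {n : ℕ} (A : SymMat n) (y : EuclideanSpace ℝ (Fin n)) :
    quadForm A.1 y = inner ℝ (svec (rankOne y)) (svec A) := by
  rw [inner_svec, quadForm]
  refine Finset.sum_congr rfl fun i _ => Finset.sum_congr rfl fun j _ => ?_
  simp only [rankOne, Matrix.of_apply]
  ring

lemma norm_svec_rankOne {n : ℕ} {y : EuclideanSpace ℝ (Fin n)} (hy : ‖y‖ = 1) :
    ‖svec (rankOne y)‖ = 1 := by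
  have h1 : ∑ i, y i ^ 2 = 1 := by
    rw [← EuclideanSpace.real_norm_sq_eq, hy, one_pow]
  rw [← sq_eq_sq₀ (norm_nonneg _) zero_le_one, ← real_inner_self_eq_norm_sq, inner_svec]
  simp only [rankOne, Matrix.of_apply]
  calc ∑ i, ∑ j, y i * y j * (y i * y j) = (∑ i, y i ^ 2) * ∑ j, y j ^ 2 := by
        rw [Finset.sum_mul_sum]
        exact Finset.sum_congr rfl fun i _ => Finset.sum_congr rfl fun j _ => by ring
    _ = 1 ^ 2 := by rw [h1]; norm_num

lemma quadForm_le_norm_svec {n : ℕ} (A : SymMat n) {y : EuclideanSpace ℝ (Fin n)}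
    (hy : ‖y‖ = 1) : quadForm A.1 y ≤ ‖svec A‖ := by
  rw [quadForm_eq_inner_svec]
  refine (real_inner_le_norm _ _).trans_eq ?_
  rw [norm_svec_rankOne hy, one_mul]

lemma measurable_entry {n : ℕ} (i j : Fin n) : Measurable fun A : SymMat n => A.1 i j := by
  have h : Measurable fun (A : SymMat n) (i j : Fin n) => A.1 i j := comap_measurable _
  exact measurable_pi_iff.1 (measurable_pi_iff.1 h i) j

lemma measurable_svec {n : ℕ} : Measurable (svec : SymMat n → EuclideanSpace ℝ (UpperIdx n)) := by
  refine (WithLp.measurable_toLp 2 _).comp (measurable_pi_iff.2 fun p => ?_)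
  split_ifs
  · exact measurable_entry _ _
  · exact (measurable_entry _ _).const_mul _

lemma meanMat_empiricalDist {n N : ℕ} (Q : Fin N → SymMat n) (i j : Fin n) :
    meanMat (empiricalDist Q) i j = (N : ℝ)⁻¹ * ∑ k, (Q k).1 i j := by
  have hm := (measurable_entry (n := n) i j).stronglyMeasurable
  simp only [meanMat, empiricalDist, Matrix.of_apply]
  rw [integral_smul_measure, integral_finsetSum_measure]
  · simp [integral_dirac' _ _ hm]
  · intro k _
    exact integrable_dirac' hm (by simp)

lemma meanMat_isSymm {n : ℕ} (P : Measure (SymMat n)) : (meanMat P).IsSymm := by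
  ext i j
  simp only [meanMat, Matrix.transpose_apply, Matrix.of_apply]
  exact integral_congr_ae (ae_of_all _ fun A => A.2.apply _ _)

lemma norm_svec_meanMat_sub_meanMat {n N : ℕ} (hN : 0 < N) {Ω : Type*} [MeasurableSpace Ω]
    {μ : Measure Ω} {P : Measure (SymMat n)} {Q : Fin N → Ω → SymMat n}
    (hQ : ∀ i, HasLaw (Q i) P μ) (hi : ∀ i, Integrable (fun ω => svec (Q i ω)) μ) (ω : Ω) :
    ‖svec ⟨meanMat (empiricalDist fun i => Q i ω) - meanMat P,
      (meanMat_isSymm _).sub (meanMat_isSymm _)⟩‖ =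
      ‖∑ i, (svec (Q i ω) - ∫ ω', svec (Q i ω') ∂μ)‖ / N := by
  have hN' : (N : ℝ) ≠ 0 := Nat.cast_ne_zero.2 hN.ne'
  have hmean (k : Fin N) (i j : Fin n) : ∫ ω', (Q k ω').1 i j ∂μ = meanMat P i j := by
    have := (hQ k).integral_comp (f := fun A : SymMat n => A.1 i j)
      (measurable_entry i j).aestronglyMeasurable
    simpa [Function.comp_def, meanMat] using this
  have hvec : svec ⟨meanMat (empiricalDist fun i => Q i ω) - meanMat P,
      (meanMat_isSymm _).sub (meanMat_isSymm _)⟩ =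
      (N : ℝ)⁻¹ • ∑ i, (svec (Q i ω) - ∫ ω', svec (Q i ω') ∂μ) := by
    ext p
    have hint (k : Fin N) : (∫ ω', svec (Q k ω') ∂μ) p = ∫ ω', svec (Q k ω') p ∂μ :=
      eval_integral_piLp (fun p => (hi k).eval_piLp p) p
    simp only [PiLp.smul_apply, WithLp.ofLp_sum, Finset.sum_apply, PiLp.sub_apply, hint, smul_eq_mul]
    simp only [svec, Matrix.sub_apply, meanMat_empiricalDist]
    split_ifs
    · simp only [hmean, Finset.sum_sub_distrib, Finset.sum_const, Finset.card_univ,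
        Fintype.card_fin, nsmul_eq_mul]
      field_simp
    · simp only [integral_const_mul, hmean, Finset.sum_sub_distrib, Finset.sum_const,
        Finset.card_univ, Fintype.card_fin, nsmul_eq_mul, ← Finset.mul_sum]
      field_simp
  rw [hvec, norm_smul, norm_inv, Real.norm_natCast, inv_mul_eq_div]

/-- The single event ‖∑ᵢ(ξᵢ − 𝔼ξᵢ)‖ ≤ N · bound serves the supremum and all fixed y. Complements are
handled by subadditivity, without measurability of the events. -/
lemma one_sub_le_measureReal_quadForm {n N : ℕ} (hN : 0 < N) {Ω : Type*} [MeasurableSpace Ω]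
    {μ : Measure Ω} [IsProbabilityMeasure μ] {P : Measure (SymMat n)} {Q : Fin N → Ω → SymMat n}
    (hQ : ∀ i, HasLaw (Q i) P μ) (hi : ∀ i, Integrable (fun ω => svec (Q i ω)) μ)
    {β bound : ℝ} (hbound : 0 ≤ bound)
    (h : μ.real {ω | N * bound < ‖∑ i, (svec (Q i ω) - ∫ ω', svec (Q i ω') ∂μ)‖} ≤ β) :
    1 - β ≤ μ.real {ω | (⨆ y : Metric.sphere (0 : EuclideanSpace ℝ (Fin n)) 1,
        quadForm (meanMat (empiricalDist fun i => Q i ω) - meanMat P) y) ≤ bound} ∧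
      ∀ y ∈ Metric.sphere (0 : EuclideanSpace ℝ (Fin n)) 1,
        1 - β ≤ μ.real {ω |
          quadForm (meanMat (empiricalDist fun i => Q i ω) - meanMat P) y ≤ bound} := by
  have hN' : (0 : ℝ) < N := Nat.cast_pos.2 hN
  have hgood (ω : Ω)
      (hω : ¬ N * bound < ‖∑ i, (svec (Q i ω) - ∫ ω', svec (Q i ω') ∂μ)‖)
      (y : EuclideanSpace ℝ (Fin n)) (hy : y ∈ Metric.sphere (0 : EuclideanSpace ℝ (Fin n)) 1) :
      quadForm (meanMat (empiricalDist fun i => Q i ω) - meanMat P) y ≤ bound := by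
    refine (quadForm_le_norm_svec ⟨meanMat (empiricalDist fun i => Q i ω) - meanMat P,
      (meanMat_isSymm _).sub (meanMat_isSymm _)⟩ (mem_sphere_zero_iff_norm.1 hy)).trans ?_
    rw [norm_svec_meanMat_sub_meanMat hN hQ hi, div_le_iff₀ hN', mul_comm]
    exact not_lt.1 hω
  have hset (A : Set Ω)
      (hA : ∀ ω, ¬ N * bound < ‖∑ i, (svec (Q i ω) - ∫ ω', svec (Q i ω') ∂μ)‖ → ω ∈ A) :
      1 - β ≤ μ.real A := by
    have hcov : (Set.univ : Set Ω) ⊆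
        A ∪ {ω | N * bound < ‖∑ i, (svec (Q i ω) - ∫ ω', svec (Q i ω') ∂μ)‖} := fun ω _ => by
      by_cases hω : N * bound < ‖∑ i, (svec (Q i ω) - ∫ ω', svec (Q i ω') ∂μ)‖
      exacts [Or.inr hω, Or.inl (hA ω hω)]
    have h1 := (measureReal_mono (μ := μ) hcov (measure_ne_top _ _)).trans
      (measureReal_union_le _ _)
    rw [probReal_univ] at h1
    linarith
  -- For n = 0 the sphere is empty and the real supremum is 0, hence the need for 0 ≤ bound.
  exact ⟨hset _ fun ω hω => Real.iSup_le (fun y => hgood ω hω y y.2) hbound,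
    fun y hy => hset _ fun ω hω => hgood ω hω y hy⟩

/-! ### Orlicz norms -/

lemma lintegral_exp_le_of_psiNorm_lt {Ω : Type*} [MeasurableSpace Ω] {μ : Measure Ω} {q : ℕ}
    {X : Ω → ℝ} {K : ℝ} (h : psiNorm q X μ < ENNReal.ofReal K) :
    ∫⁻ ω, ENNReal.ofReal (Real.exp (|X ω| ^ q / K ^ q)) ∂μ ≤ 2 := by
  simp only [psiNorm, iInf_lt_iff] at h
  obtain ⟨t, ht, hle, htK⟩ := h
  refine (lintegral_mono fun ω => ?_).trans hle
  have htK' : t < K := (ENNReal.ofReal_lt_ofReal_iff_of_nonneg ht.le).1 htK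
  gcongr

/-- The event at K is the increasing union of the events at K + 1/(k + 1), so continuity from below
applies. -/
lemma measureReal_mul_lt_le_of_forall_gt {Ω : Type*} [MeasurableSpace Ω] {μ : Measure Ω}
    [IsFiniteMeasure μ] {f : Ω → ℝ} {a K β : ℝ} (ha : 0 ≤ a) (hβ : 0 ≤ β)
    (h : ∀ K' > K, μ.real {ω | a * K' < f ω} ≤ β) : μ.real {ω | a * K < f ω} ≤ β := by
  let u : ℕ → ℝ := fun k => 1 / ((k : ℝ) + 1)
  have hu : Filter.Tendsto (fun k => a * (K + u k)) Filter.atTop (nhds (a * K)) := by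
    simpa [u] using ((tendsto_one_div_add_atTop_nhds_zero_nat (𝕜 := ℝ)).const_add K).const_mul a
  have hset : {ω | a * K < f ω} ⊆ ⋃ k, {ω | a * (K + u k) < f ω} := by
    intro ω hω
    obtain ⟨k, hk⟩ := (hu.eventually_lt_const hω).exists
    exact Set.mem_iUnion.2 ⟨k, hk⟩
  have hmono : Monotone fun k => {ω | a * (K + u k) < f ω} := by
    intro k l hkl ω hω
    rw [Set.mem_ofPred_eq] at hω ⊢
    refine lt_of_le_of_lt ?_ hω
    have : u l ≤ u k := Nat.one_div_le_one_div hkl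
    gcongr
  refine ENNReal.toReal_le_of_le_ofReal hβ ((measure_mono hset).trans ?_)
  rw [hmono.measure_iUnion]
  refine iSup_le fun k => ?_
  rw [← ENNReal.ofReal_toReal (measure_ne_top μ _)]
  refine ENNReal.ofReal_le_ofReal (h _ ?_)
  have : 0 < u k := Nat.one_div_pos_of_nat
  linarith

lemma lintegral_exp_inner_le_of_gt_psiNormVec {Ω ι κ : Type*} [MeasurableSpace Ω] {μ : Measure Ω}
    [Fintype ι] [Finite κ] {q : ℕ} {X : κ → Ω → EuclideanSpace ℝ ι}
    (hX : ∀ i, psiNormVec q (X i) μ < ∞) {K : ℝ}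
    (hK : (⨆ i, psiNormVec q (X i) μ).toReal < K) (i : κ) {z : EuclideanSpace ℝ ι}
    (hz : ‖z‖ = 1) :
    ∫⁻ ω, ENNReal.ofReal (Real.exp (|inner ℝ z (X i ω)| ^ q / K ^ q)) ∂μ ≤ 2 := by
  have : Nonempty κ := ⟨i⟩
  -- A finite maximum of finite norms is finite, so `toReal` does not send it from ∞ to 0.
  have hfin : (⨆ i, psiNormVec q (X i) μ) ≠ ∞ := by
    obtain ⟨j, hj⟩ := exists_eq_ciSup_of_finite (f := fun i => psiNormVec q (X i) μ)
    exact hj ▸ (hX j).ne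
  refine lintegral_exp_le_of_psiNorm_lt (X := fun ω => inner ℝ z (X i ω)) ?_
  refine lt_of_le_of_lt ?_ ((ENNReal.lt_ofReal_iff_toReal_lt hfin).2 hK)
  refine le_trans ?_ (le_iSup (fun i => psiNormVec q (X i) μ) i)
  exact le_iSup (fun y : Metric.sphere (0 : EuclideanSpace ℝ ι) 1 =>
    psiNorm q (fun ω => inner ℝ (y : EuclideanSpace ℝ ι) (X i ω)) μ)
    ⟨z, mem_sphere_zero_iff_norm.2 hz⟩

/-- Coordinates are inner products with unit vectors, and t ≤ exp(t^q) for t ≥ 0 and q ≥ 1 dominates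
them. -/
lemma integrable_of_psiNormVec_lt_top {Ω ι : Type*} [MeasurableSpace Ω] {μ : Measure Ω}
    [IsProbabilityMeasure μ] [Fintype ι] {q : ℕ} (hq : q ≠ 0) {X : Ω → EuclideanSpace ℝ ι}
    (hX : AEMeasurable X μ) (h : psiNormVec q X μ < ∞) : Integrable X μ := by
  classical
  refine Integrable.of_eval_piLp fun p => ?_
  set K := (psiNormVec q X μ).toReal + 1
  have hK : 0 < K := by positivity
  have h1 := lintegral_exp_inner_le_of_gt_psiNormVec (κ := Unit) (X := fun _ => X) (q := q)
    (μ := μ) (fun _ => h) (K := K) (by simp [K]) () (z := EuclideanSpace.single p 1) (by simp)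
  have hm : AEMeasurable (fun ω => X ω p) μ := by fun_prop
  simp only [EuclideanSpace.inner_single_left, map_one, one_mul] at h1
  have h2 := integrable_and_integral_le_of_lintegral_le (μ := μ) (c := 2)
    (f := fun ω => Real.exp (|X ω p| ^ q / K ^ q)) (by norm_num)
    (Real.measurable_exp.comp_aemeasurable (((continuous_abs.measurable.comp_aemeasurable
      hm).pow_const q).div_const _)) (fun ω => (Real.exp_pos _).le)
    (by simpa only [ENNReal.ofReal_ofNat] using h1)
  refine (h2.1.const_mul K).mono' hm.aestronglyMeasurable (ae_of_all _ fun ω => ?_)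
  rw [← div_le_iff₀' hK, Real.norm_eq_abs]
  have h3 := Real.add_one_le_exp (|X ω p| ^ q / K ^ q)
  rw [← div_pow] at h3 ⊢
  have h4 : 0 ≤ |X ω p| / K := by positivity
  rcases le_total (|X ω p| / K) 1 with h5 | h5
  · linarith [pow_nonneg h4 q]
  · linarith [le_self_pow₀ h5 hq]

/-! ### Constants and the final bounds -/

/-- Since 5 ≤ e², the term 2d of the exponent absorbs the size of the net; half of the remaining 2
log(2/β) already gives β. -/
lemma five_pow_mul_exp_le {β : ℝ} (hβ : 0 < β) (hβ1 : β < 1) (d : ℕ) :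
    5 ^ d * (2 * Real.exp (-(2 * (d + Real.log (2 / β))))) ≤ β := by
  have hlog : 0 ≤ Real.log (2 / β) := Real.log_nonneg (by rw [le_div_iff₀ hβ]; linarith)
  have h5 : (5 : ℝ) ≤ Real.exp 2 := by
    rw [show (2 : ℝ) = 1 + 1 by norm_num, Real.exp_add]
    nlinarith [Real.exp_one_gt_d9]
  have hpow : (5 : ℝ) ^ d ≤ Real.exp (2 * d) := by
    rw [mul_comm, Real.exp_nat_mul]
    gcongr
  calc 5 ^ d * (2 * Real.exp (-(2 * (d + Real.log (2 / β)))))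
      ≤ Real.exp (2 * d) * (2 * Real.exp (-(2 * (d + Real.log (2 / β))))) := by gcongr
    _ = 2 * Real.exp (-(2 * Real.log (2 / β))) := by
        rw [mul_left_comm, ← Real.exp_add]
        ring_nf
    _ ≤ 2 * Real.exp (-Real.log (2 / β)) := by gcongr; linarith
    _ = β := by
        rw [Real.exp_neg, Real.exp_log (by positivity)]
        field_simp

lemma mul_sqrt_div {N x : ℝ} (hN : 0 < N) : N * √(x / N) = √(x * N) := by
  rw [← Real.sqrt_sq hN.le, ← Real.sqrt_mul (sq_nonneg N), Real.sqrt_sq hN.le]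
  congr 1
  field_simp

theorem mainTheorem9 :
    ∃ C : ℝ, 0 < C ∧
      ∀ (n N : ℕ), 0 < N →
      ∀ (Ω : Type*) [MeasurableSpace Ω] (μ : Measure Ω) [IsProbabilityMeasure μ]
        (Ptrue : Measure (SymMat n)) (Q : Fin N → Ω → SymMat n),
      -- the samples are drawn independently from `Ptrue`
      (∀ i, HasLaw (Q i) Ptrue μ) → iIndepFun Q μ →
      ∀ β : ℝ, 0 < β → β < 1 →
      -- sub-exponential samples, uniformly in `y` and for each fixed `y`
      ((∀ i, IsSubExponentialVec (fun ω => svec (Q i ω)) μ) →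
        ∀ (m K bound : ℝ), m = (n : ℝ) * (n + 1) / 2 →
          K = (⨆ i, psiNormVec 1 (fun ω => svec (Q i ω)) μ).toReal →
          bound = C * K * (Real.sqrt ((m + Real.log (2 / β)) / N) +
            (m + Real.log (2 / β)) / N) →
          1 - β ≤ μ.real {ω | (⨆ y : Metric.sphere (0 : EuclideanSpace ℝ (Fin n)) 1,
            quadForm (meanMat (empiricalDist fun i => Q i ω) - meanMat Ptrue) y) ≤ bound} ∧
          ∀ y ∈ Metric.sphere (0 : EuclideanSpace ℝ (Fin n)) 1,
            1 - β ≤ μ.real {ω |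
              quadForm (meanMat (empiricalDist fun i => Q i ω) - meanMat Ptrue) y ≤ bound}) ∧
      -- sub-exponential samples whose Euclidean norms have `ψ₁`-norm at most `R`
      ((∀ i, IsSubExponentialVec (fun ω => svec (Q i ω)) μ) →
        ∀ (R bound : ℝ), 0 < R →
          (∀ i, psiNorm 1 (fun ω => ‖svec (Q i ω)‖) μ ≤ ENNReal.ofReal R) →
          bound = 2 * Real.sqrt 2 * R * Real.sqrt (2 * Real.log (2 / β) / N) +
            R * Real.log (2 / β) / N →
          1 - β ≤ μ.real {ω | (⨆ y : Metric.sphere (0 : EuclideanSpace ℝ (Fin n)) 1,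
            quadForm (meanMat (empiricalDist fun i => Q i ω) - meanMat Ptrue) y) ≤ bound} ∧
          ∀ y ∈ Metric.sphere (0 : EuclideanSpace ℝ (Fin n)) 1,
            1 - β ≤ μ.real {ω |
              quadForm (meanMat (empiricalDist fun i => Q i ω) - meanMat Ptrue) y ≤ bound}) ∧
      -- sub-Gaussian samples
      ((∀ i, IsSubGaussianVec (fun ω => svec (Q i ω)) μ) →
        ∀ (m K bound : ℝ), m = (n : ℝ) * (n + 1) / 2 →
          K = (⨆ i, psiNormVec 2 (fun ω => svec (Q i ω)) μ).toReal →
          bound = C * K * (Real.sqrt (m / N) + Real.sqrt (Real.log (2 / β) / N)) →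
          1 - β ≤ μ.real {ω | (⨆ y : Metric.sphere (0 : EuclideanSpace ℝ (Fin n)) 1,
            quadForm (meanMat (empiricalDist fun i => Q i ω) - meanMat Ptrue) y) ≤ bound} ∧
          ∀ y ∈ Metric.sphere (0 : EuclideanSpace ℝ (Fin n)) 1,
            1 - β ≤ μ.real {ω |
              quadForm (meanMat (empiricalDist fun i => Q i ω) - meanMat Ptrue) y ≤ bound}) := by
  -- The sub-Gaussian case needs 2√120 ≤ 24; the sub-exponential one needs only 8√2 and 4.
  refine ⟨24, by norm_num, ?_⟩
  intro n N hN Ω _ μ _ Ptrue Q hQ hind β hβ hβ1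
  have hN' : (0 : ℝ) < N := Nat.cast_pos.2 hN
  have : Nonempty (Fin N) := ⟨⟨0, hN⟩⟩
  have hlog : 0 ≤ Real.log (2 / β) := Real.log_nonneg (by rw [le_div_iff₀ hβ]; linarith)
  have hXm (i) : AEMeasurable (fun ω => svec (Q i ω)) μ :=
    measurable_svec.comp_aemeasurable (hQ i).aemeasurable
  have hXind : iIndepFun (fun i ω => svec (Q i ω)) μ :=
    hind.comp (fun _ => svec) fun _ => measurable_svec
  have hd := card_upperIdx n
  have hprob := five_pow_mul_exp_le hβ hβ1 (Fintype.card (UpperIdx n))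
  rw [hd] at hprob
  have hsqrt2 : √2 ≤ 3 / 2 := by rw [Real.sqrt_le_left (by norm_num)]; norm_num
  refine ⟨?_, ?_, ?_⟩
  · intro hsub m K bound hm hK hbound
    rw [← hm] at hprob
    have hm0 : 0 ≤ m := by rw [hm]; positivity
    have hK0 : 0 ≤ K := by rw [hK]; positivity
    have hx : 0 ≤ m + Real.log (2 / β) := by positivity
    have hXi (i) := integrable_of_psiNormVec_lt_top one_ne_zero (hXm i) (hsub i)
    refine one_sub_le_measureReal_quadForm hN hQ hXi (by rw [hbound]; positivity) ?_
    set x := m + Real.log (2 / β)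
    rw [hbound, show N * (24 * K * (√(x / N) + x / N)) = 24 * (√(x * N) + x) * K by
      rw [← mul_sqrt_div hN']; field_simp]
    refine measureReal_mul_lt_le_of_forall_gt (by positivity) hβ.le fun K' hK' => ?_
    have hK'0 : 0 < K' := hK0.trans_lt hK'
    refine le_trans (measureReal_mono fun ω hω => ?_)
      ((measureReal_norm_sum_gt_le_of_subexponential hXind hXi hK'0
        (fun i z hz => by
          simpa only [pow_one] using
            lintegral_exp_inner_le_of_gt_psiNormVec hsub (hK ▸ hK') i hz)
        (L := 2 * x) (by positivity)).trans
        (by rw [finrank_euclideanSpace]; exact hprob))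
    rw [Set.mem_ofPred_eq] at hω ⊢
    refine lt_of_le_of_lt ?_ hω
    rw [Fintype.card_fin, mul_assoc 2 x, Real.sqrt_mul zero_le_two]
    have h0 : 0 ≤ √(x * N) := Real.sqrt_nonneg _
    have h1 : 2 * (4 * (√2 * √(x * N)) + 2 * x) ≤ 24 * (√(x * N) + x) := by nlinarith
    nlinarith
  · intro hsub R bound hR hpsi hbound
    have hXi (i) := integrable_of_psiNormVec_lt_top one_ne_zero (hXm i) (hsub i)
    refine one_sub_le_measureReal_quadForm hN hQ hXi (by rw [hbound]; positivity) ?_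
    set x := Real.log (2 / β) with hx
    -- 2√2 · √2 = 4: this is exactly the Hilbert space bound with L = log(2/β), whose tail 2 exp(−L)
    -- equals β.
    rw [hbound, show N * (2 * √2 * R * √(2 * x / N) + R * x / N) =
        (4 * √(x * N) + x) * R by
      rw [← mul_sqrt_div hN', mul_div_assoc 2 x, Real.sqrt_mul zero_le_two]
      field_simp
      rw [Real.sq_sqrt zero_le_two]
      ring]
    refine measureReal_mul_lt_le_of_forall_gt (by positivity) hβ.le fun R' hR' => ?_
    have hR'0 : 0 < R' := hR.trans hR'
    have hB := measureReal_norm_sum_sub_integral_gt_le hXind hXm hR'0 (fun i => by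
      have h1 := lintegral_exp_le_of_psiNorm_lt
        ((hpsi i).trans_lt ((ENNReal.ofReal_lt_ofReal_iff hR'0).2 hR'))
      simpa only [pow_one, abs_norm] using h1) hlog
    rw [Fintype.card_fin, mul_comm R'] at hB
    refine hB.trans_eq ?_
    rw [Real.exp_neg, Real.exp_log (by positivity)]
    field_simp
  · intro hsub m K bound hm hK hbound
    rw [← hm] at hprob
    have hm0 : 0 ≤ m := by rw [hm]; positivity
    have hK0 : 0 ≤ K := by rw [hK]; positivity
    have hXi (i) := integrable_of_psiNormVec_lt_top two_ne_zero (hXm i) (hsub i)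
    refine one_sub_le_measureReal_quadForm hN hQ hXi (by rw [hbound]; positivity) ?_
    set l := Real.log (2 / β)
    rw [hbound, show N * (24 * K * (√(m / N) + √(l / N))) =
        24 * (√(m * N) + √(l * N)) * K by
      rw [← mul_sqrt_div hN', ← mul_sqrt_div hN']; ring]
    refine measureReal_mul_lt_le_of_forall_gt (by positivity) hβ.le fun K' hK' => ?_
    have hK'0 : 0 < K' := hK0.trans_lt hK'
    refine le_trans (measureReal_mono fun ω hω => ?_)
      ((measureReal_norm_sum_gt_le_of_subgaussian hXind hXi hK'0
        (fun i z hz => lintegral_exp_inner_le_of_gt_psiNormVec hsub (hK ▸ hK') i hz)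
        (L := 2 * (m + l)) (by positivity)).trans ?_)
    · rw [Set.mem_ofPred_eq] at hω ⊢
      refine lt_of_le_of_lt ?_ hω
      rw [Fintype.card_fin]
      have h1 : √(60 * (2 * (m + l)) * N) ≤ 12 * (√(m * N) + √(l * N)) := by
        rw [Real.sqrt_le_left (by positivity)]
        have h2 := Real.sq_sqrt (show 0 ≤ m * N by positivity)
        have h3 := Real.sq_sqrt (show 0 ≤ l * N by positivity)
        nlinarith [mul_nonneg (Real.sqrt_nonneg (m * N)) (Real.sqrt_nonneg (l * N)),
          mul_nonneg hm0 hN'.le, mul_nonneg hlog hN'.le]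
      nlinarith
    · rw [finrank_euclideanSpace]
      refine le_trans ?_ hprob
      gcongr
      linarith [Real.exp_pos (-(2 * (m + l)))]
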